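/- **Setting.** Let $\mathcal P$ be a finite set of modes. To each $\phi\in\mathcal P$ is attached a signed digraph $\mathcal G_\phi$ with $N_\phi$ nodes and $M_\phi$ edges, unweighted ($a_{ij}\in\{0,1,-1\}$, with $a_{ij}\neq0$ iff there is an edge from node $j$ to node $i$), without self-loops, and digon sign-symmetric ($a_{ij}a_{ji}\ge0$). Its incidence matrix $E_\phi\in\mathbb R^{N_\phi\times M_\phi}$ has in the column of an edge from $j$ to $i$ the entries $+1$ in row $j$ and $-a_{ij}$ in row $i$, and $0$ elsewhere; the in-incidence matrix $E_{\odot\phi}$ keeps only the entry $-a_{ij}$ in row $i$. The signed edge Laplacian is $L_\phi=E_\phi^\top E_{\odot\phi}$. Let $\xi_\phi$ be the number of its zero eigenvalues (with algebraic multiplicity), and let $v_{r_{\phi_i}},v_{l_{\phi_i}}$, $i\le\xi_\phi$, be associated right and left (if $0$ is not semisimple: generalized) eigenvectors, normalized by $v_{l_{\phi_i}}^\top v_{r_{\phi_j}}=\delta_{ij}$. In mode $\phi$ the agents $\dot x=u$, $x\in\mathbb R^{N_\phi}$, have the edge states $e_\phi=E_\phi^\top x$, the control law $u=-k_1E_{\odot\phi}e_\phi$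 with $k_1>0$, and the synchronization errors $\bar e_\phi=\big[I-\sum_{i}v_{r_{\phi_i}}v_{l_{\phi_i}}^\top\big]e_\phi$, which then satisfy $\dot{\bar e}_\phi=-k_1L_\phi\bar e_\phi$. At a switching instant $t_l$ from $\hat\phi$ to $\phi$ the errors jump: $\bar e_\phi(t_l^+)=\Xi_{\phi,\hat\phi}\,\bar e_{\hat\phi}(t_l^-)+\Phi_l$, where $\Xi_{\phi,\hat\phi}$ is a $\{0,1\}$-matrix with at most one $1$ in each row and each column, and the vectors $\Phi_l$ are uniformly bounded, $|\Phi_l|\le\bar\Phi$. For given $\alpha_{\phi_i}>0$, let $P_\phi=P_\phi^\top>0$ satisfy $P_\phi L_\phi+L_\phi^\top P_\phi=I$ if $\mathcal G_\phi$ is a directed spanning tree, and $P_\phi L_\phi+L_\phi^\top P_\phi=I-\sum_{i=1}^{\xi_\phi}\alpha_{\phi_i}\big(P_\phi v_{r_{\phi_i}}v_{l_{\phi_i}}^\top+v_{l_{\phi_i}}v_{r_{\phi_i}}^\top P_\phi\big)$ otherwise. A switching signal $\sigma:[t_0,\infty)\to\mathcal P$, $t_0\ge0$ (piecewise constant, with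 finitely many switchings on bounded intervals) has the transition-dependent average dwell time $\tau_{\phi,\hat\phi}>0$, with chatter bound $\hat N_{\phi,\hat\phi}\ge0$, if for all $t_0\le s<t$ and all $\phi,\hat\phi\in\mathcal P$ $$N_{\phi,\hat\phi}(s,t)\le\hat N_{\phi,\hat\phi}+\frac{T_{\phi,\hat\phi}(s,t)}{\tau_{\phi,\hat\phi}},$$ where $N_{\phi,\hat\phi}(s,t)$ is the number of switchings from $\hat\phi$ to $\phi$ within $[s,t)$ and $T_{\phi,\hat\phi}(s,t)$ is the total time within $[s,t)$ during which $\phi$ is active as the successor of $\hat\phi$. **Theorem.** Suppose that the initial digraph $\mathcal G_{\sigma(t_0)}$ contains a directed spanning tree, and that $\sigma$ has a transition-dependent average dwell time satisfying $$\tau_{\phi,\hat\phi}\ge\frac{\ln\Omega_{\phi,\hat\phi}}{\gamma_\phi},\qquad \Omega_{\phi,\hat\phi}=1+2\,\frac{\lambda_{\max}(P_\phi)}{\lambda_{\min}(P_{\hat\phi})},\qquad \gamma_\phi=\frac{k_1}{\lambda_{\max}(P_\phi)} .$$ Then the origin of the switched synchronization-error system is globally uniformly practically stable: there are a class $\mathcal{KL}$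 function $\beta$ and an $\epsilon\ge0$ (depending only on the digraphs, $k_1$, the eigenvectors, $\alpha$, $P$, $\Xi$, $\tau$, $\hat N$ and $\bar\Phi$) such that, for every such signal $\sigma$, every initial time and initial state, and all impulses with $|\Phi_l|\le\bar\Phi$, $$|\bar e_{\sigma(t)}(t)|\le\beta\big(|\bar e_{\sigma(t_0)}(t_0)|,\,t-t_0\big)+\epsilon\qquad\text{for all }t\ge t_0 .$$ -/

import Mathlib

open Filter Topology MeasureTheory

noncomputable section

/-- An unweighted signed digraph on the nodes `Fin N`, without self-loops and digon
sign-symmetric. `a i j` is the sign of the edge from node `j` to node `i`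
(`0` when there is no such edge, `1` when it is cooperative, `-1` when it is antagonistic). -/
structure SignedDigraph (N : ℕ) where
  a : Fin N → Fin N → SignType
  no_loop : ∀ i, a i i = 0
  digon_symm : ∀ i j, 0 ≤ a i j * a j i

/-- A relation (`r u v`: there is an edge from `u` to `v`) is a directed tree that includes
all the nodes: the root has no incoming edge, every other node has exactly one parent, and
every node is reached from the root by a directed path. -/
def IsDirectedTreeRel {V : Type*} (r : V → V → Prop) : Prop :=
  ∃ root : V, (∀ u, ¬ r u root) ∧ (∀ v, v ≠ root → ∃! u, r u v) ∧
    ∀ v, Relation.ReflTransGen r root v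

namespace SignedDigraph

variable {N : ℕ} (G : SignedDigraph N)

/-- There is an edge from `j` to `i`. -/
def HasEdge (j i : Fin N) : Prop := G.a i j ≠ 0

/-- The digraph is a directed spanning tree. -/
def IsDirectedTree : Prop := IsDirectedTreeRel G.HasEdge

/-- The digraph contains a directed spanning tree. -/
def ContainsDirectedSpanningTree : Prop :=
  ∃ r : Fin N → Fin N → Prop, (∀ u v, r u v → G.HasEdge u v) ∧ IsDirectedTreeRel r

/-- The edges: pairs (initial node, terminal node). -/
abbrev Edge : Type := {p : Fin N × Fin N // G.a p.2 p.1 ≠ 0}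

/-- The signed incidence matrix: `+1` at the initial node of an edge; at the terminal node
`-1` if the edge is cooperative and `+1` if it is antagonistic. -/
def incidence : Matrix (Fin N) G.Edge ℝ := fun i k =>
  if i = k.1.1 then 1 else if i = k.1.2 then -((G.a k.1.2 k.1.1 : SignType) : ℝ) else 0

/-- The signed in-incidence matrix: only the entries at the terminal nodes are kept. -/
def inIncidence : Matrix (Fin N) G.Edge ℝ := fun i k =>
  if i = k.1.2 then -((G.a k.1.2 k.1.1 : SignType) : ℝ) else 0

/-- The signed edge Laplacian. -/
def edgeLaplacian : Matrix G.Edge G.Edge ℝ := G.incidence.transpose * G.inIncidence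

/-- The number of zero eigenvalues of the edge Laplacian (with algebraic multiplicity). -/
def numZero : ℕ := G.edgeLaplacian.charpoly.rootMultiplicity 0

/-- `vr i`, `vl i` are right and left eigenvectors of the edge Laplacian associated with its
zero eigenvalues, normalized by `vl i ⬝ vr j = δ i j`. There are as many as the algebraic
multiplicity of the eigenvalue `0`; when `0` is not semisimple they are generalized
eigenvectors (the columns of a Jordan basis and the rows of its inverse are of this kind). -/
structure IsZeroEigenvectors (vr vl : Fin G.numZero → G.Edge → ℝ) : Prop where
  right : ∀ i, (G.edgeLaplacian ^ Fintype.card G.Edge).mulVec (vr i) = 0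
  left : ∀ i, Matrix.vecMul (vl i) (G.edgeLaplacian ^ Fintype.card G.Edge) = 0
  normalized : ∀ i j, vl i ⬝ᵥ vr j = if i = j then 1 else 0

/-- `P` is a symmetric positive definite matrix generated by the Lyapunov equation
`P L + Lᵀ P = I` if the digraph is a directed spanning tree, and by
`P L + Lᵀ P = I - ∑ αᵢ (P vrᵢ vlᵢᵀ + vlᵢ vrᵢᵀ P)` otherwise. -/
structure IsLyapunovMatrix (vr vl : Fin G.numZero → G.Edge → ℝ) (α : Fin G.numZero → ℝ)
    (P : Matrix G.Edge G.Edge ℝ) : Prop where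
  posDef : P.PosDef
  tree : G.IsDirectedTree →
    P * G.edgeLaplacian + G.edgeLaplacian.transpose * P = 1
  general : ¬ G.IsDirectedTree →
    P * G.edgeLaplacian + G.edgeLaplacian.transpose * P =
      1 - ∑ i, α i • (P * Matrix.vecMulVec (vr i) (vl i) + Matrix.vecMulVec (vl i) (vr i) * P)

/-- The edge states of the agents' state `x`. -/
def edgeState (x : Fin N → ℝ) : G.Edge → ℝ := G.incidence.transpose.mulVec x

/-- The signed edge-based control law with gain `k₁`. -/
def control (k₁ : ℝ) (x : Fin N → ℝ) : Fin N → ℝ :=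
  -(k₁ • G.inIncidence.mulVec (G.edgeState x))

/-- The synchronization errors: edge states minus weighted edge average state. -/
def syncError (vr vl : Fin G.numZero → G.Edge → ℝ) (x : Fin N → ℝ) : G.Edge → ℝ :=
  G.edgeState x - ∑ i, (vl i ⬝ᵥ G.edgeState x) • vr i

end SignedDigraph

/-- The largest eigenvalue of a (symmetric) matrix. -/
def lambdaMax {n : Type*} [Fintype n] [DecidableEq n] (P : Matrix n n ℝ) : ℝ :=
  sSup (spectrum ℝ P)

/-- The smallest eigenvalue of a (symmetric) matrix. -/
def lambdaMin {n : Type*} [Fintype n] [DecidableEq n] (P : Matrix n n ℝ) : ℝ :=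
  sInf (spectrum ℝ P)

/-- The Euclidean norm. -/
def euclNorm {n : Type*} [Fintype n] (v : n → ℝ) : ℝ := ‖WithLp.toLp 2 v‖

/-- A submatrix of an identity matrix, up to the enumeration of rows and columns: entries in
`{0, 1}`, with at most one `1` in each row and in each column. -/
structure IsSelectionMatrix {m n : Type*} (X : Matrix m n ℝ) : Prop where
  zero_or_one : ∀ i j, X i j = 0 ∨ X i j = 1
  row : ∀ i j j', X i j = 1 → X i j' = 1 → j = j'
  col : ∀ i i' j, X i j = 1 → X i' j = 1 → i = i'

/-- A piecewise constant, right-continuous switching signal with values in `Q`, on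
`[time 0, ∞)`, with finitely or infinitely many switchings and no accumulation of them.
`mode l` is the mode active on `[time l, time (l + 1))`, and on `[time l, ∞)` if `l` is the
number of switchings. Entries of `time` and `mode` beyond the number of switchings have no
meaning. -/
structure SwitchingSignal (Q : Type*) where
  numSwitches : ℕ∞
  time : ℕ → ℝ
  mode : ℕ → Q
  time_nonneg : 0 ≤ time 0
  time_lt : ∀ l : ℕ, ((l + 1 : ℕ) : ℕ∞) ≤ numSwitches → time l < time (l + 1)
  no_zeno : numSwitches = ⊤ → Tendsto time atTop atTop

namespace SwitchingSignal

variable {Q : Type*} (S : SwitchingSignal Q)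

/-- The interval on which the `l`-th mode is active. -/
def phase (l : ℕ) : Set ℝ :=
  {t | (l : ℕ∞) ≤ S.numSwitches ∧ S.time l ≤ t ∧
    (((l + 1 : ℕ) : ℕ∞) ≤ S.numSwitches → t < S.time (l + 1))}

/-- The same interval together with its right end point (if it has one). -/
def closedPhase (l : ℕ) : Set ℝ :=
  {t | (l : ℕ∞) ≤ S.numSwitches ∧ S.time l ≤ t ∧
    (((l + 1 : ℕ) : ℕ∞) ≤ S.numSwitches → t ≤ S.time (l + 1))}

/-- The number of switchings from mode `φ'` to mode `φ` within `[s, t)`. -/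
def switchCount (φ φ' : Q) (s t : ℝ) : ℕ :=
  Set.ncard {l : ℕ | ((l + 1 : ℕ) : ℕ∞) ≤ S.numSwitches ∧ S.time (l + 1) ∈ Set.Ico s t ∧
    S.mode l = φ' ∧ S.mode (l + 1) = φ}

/-- The total active duration within `[s, t)` of mode `φ` as successor of mode `φ'`. -/
def activeDuration (φ φ' : Q) (s t : ℝ) : ℝ :=
  (volume {r : ℝ | r ∈ Set.Ico s t ∧
    ∃ l : ℕ, r ∈ S.phase (l + 1) ∧ S.mode l = φ' ∧ S.mode (l + 1) = φ}).toReal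

/-- `τ` is a (slow) transition-dependent average dwell time of the signal, with chatter
bounds `Nhat`. -/
def HasAverageDwellTime (Nhat τ : Q → Q → ℝ) : Prop :=
  ∀ φ φ' : Q, ∀ s t : ℝ, S.time 0 ≤ s → s < t →
    (S.switchCount φ φ' s t : ℝ) ≤ Nhat φ φ' + S.activeDuration φ φ' s t / τ φ φ'

end SwitchingSignal

/-- Class `𝒦` functions on `[0, ∞)`. -/
structure IsClassK (κ : ℝ → ℝ) : Prop where
  continuousOn : ContinuousOn κ (Set.Ici 0)
  strictMonoOn : StrictMonoOn κ (Set.Ici 0)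
  zero : κ 0 = 0

/-- Class `𝒦ℒ` functions on `[0, ∞) × [0, ∞)`. -/
structure IsClassKL (β : ℝ → ℝ → ℝ) : Prop where
  continuousOn : ContinuousOn (fun p : ℝ × ℝ => β p.1 p.2) (Set.Ici 0 ×ˢ Set.Ici 0)
  classK : ∀ t, 0 ≤ t → IsClassK (fun r => β r t)
  antitoneOn : ∀ r, 0 ≤ r → AntitoneOn (β r) (Set.Ici 0)
  tendsto_zero : ∀ r, 0 ≤ r → Tendsto (β r) atTop (𝓝 0)

section OpenMAS

variable {Q : Type*} {N : Q → ℕ} (G : ∀ φ, SignedDigraph (N φ)) (k₁ : ℝ)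
  (vr vl : ∀ φ, Fin (G φ).numZero → (G φ).Edge → ℝ)
  (Ξ : ∀ φ φ', Matrix (G φ).Edge (G φ').Edge ℝ)

/-- A trajectory of the open multi-agent system in closed loop with the edge-based control law.
`x l` is the agents' state during the `l`-th phase (its value at the right end point of the phase
is the limit from the left, just before the switching), and `Φ l` is the impulse with which the
`l`-th phase starts. The agents are single integrators driven by the control law of the active
mode, and at a switching the synchronization errors jump from `ē⁻` to `Ξ ē⁻ + Φ`. -/
structure IsTrajectory (S : SwitchingSignal Q) (x : ∀ l : ℕ, ℝ → Fin (N (S.mode l)) → ℝ)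
    (Φ : ∀ l : ℕ, (G (S.mode l)).Edge → ℝ) : Prop where
  flow : ∀ l : ℕ, ∀ t ∈ S.closedPhase l,
    HasDerivWithinAt (x l) ((G (S.mode l)).control k₁ (x l t)) (S.closedPhase l) t
  jump : ∀ l : ℕ, ((l + 1 : ℕ) : ℕ∞) ≤ S.numSwitches →
    (G (S.mode (l + 1))).syncError (vr _) (vl _) (x (l + 1) (S.time (l + 1))) =
      (Ξ (S.mode (l + 1)) (S.mode l)).mulVec
        ((G (S.mode l)).syncError (vr _) (vl _) (x l (S.time (l + 1)))) + Φ (l + 1)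

/-- Global uniform practical stability of the origin of the switched synchronization-error
system: one `𝒦ℒ` function and one ultimate bound serve for all initial times and states, all
admissible switching signals and all impulses bounded by `Φbar`. -/
def IsGloballyUniformlyPracticallyStable (Φbar : ℝ) (admissible : Set (SwitchingSignal Q)) :
    Prop :=
  ∃ (β : ℝ → ℝ → ℝ) (ε : ℝ), IsClassKL β ∧ 0 ≤ ε ∧
    ∀ S ∈ admissible, ∀ (x : ∀ l : ℕ, ℝ → Fin (N (S.mode l)) → ℝ)
      (Φ : ∀ l : ℕ, (G (S.mode l)).Edge → ℝ),
      IsTrajectory G k₁ vr vl Ξ S x Φ →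
      (∀ l : ℕ, ((l + 1 : ℕ) : ℕ∞) ≤ S.numSwitches → euclNorm (Φ (l + 1)) ≤ Φbar) →
      ∀ l : ℕ, ∀ t ∈ S.phase l,
        euclNorm ((G (S.mode l)).syncError (vr _) (vl _) (x l t)) ≤
          β (euclNorm ((G (S.mode 0)).syncError (vr _) (vl _) (x 0 (S.time 0))))
            (t - S.time 0) + ε

end OpenMAS

end

/-! The proof uses the multiple Lyapunov functions `V_φ(e) = eᵀ P_φ e`, evaluated on the
synchronization error.

Between switchings, `∑ vr_i vl_iᵀ` is the spectral projection onto the generalized null space of the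
edge Laplacian `L`, so it commutes with `L` and the error obeys `ē' = -k₁ L ē`. Moreover `vl_i ⬝ ē =
0`, which kills the correction terms of the Lyapunov equation. Hence `V' = -k₁ |ē|² ≤ -γ V`, with `γ
= k₁ / λ_max(P_φ)` (`IsLyapunovMatrix.le_exp_mul`).

At a switching, `V⁺ ≤ μ V⁻ + c` with `μ = 2 λ_max(P_φ) / λ_min(P_φ')` (`dotProduct_mulVec_jump_le`).
The dwell time condition is not strict, so the factor `Ω = 1 + μ` would leave no decay. But `μ v + c
≤ max 1 (μ + 1/2) * max v (2c)`, and the logarithm `m` of this smaller factor satisfies `m < γ τ`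
strictly. Since there are finitely many pairs of modes, one margin `δ > 0` serves them all.

Along a trajectory, either `V` was above `2c` just before every switching, or there is a last
switching before which it was not. Counting growth against decay from the start, or from that
switching, gives a decaying term or a constant (`HasAverageDwellTime.sum_sub_le`,
`HasAverageDwellTime.lyapunov_le`). -/

noncomputable section

/-! ### Biorthogonal bases of the generalized null space. -/

section LinearAlgebra

open Matrix Module

variable {n : Type*} [Fintype n]

/-- Generalized null vectors, as many as the algebraic multiplicity of the eigenvalue `0`, span
the generalized null space. -/
theorem mem_span_of_pow_mulVec_eq_zero [DecidableEq n] {B : Matrix n n ℝ} {k : ℕ}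
    {v : Fin (B.charpoly.rootMultiplicity 0) → n → ℝ} (hli : LinearIndependent ℝ v)
    (hv : ∀ i, (B ^ k).mulVec (v i) = 0) {u : n → ℝ} (hu : (B ^ k).mulVec u = 0) :
    u ∈ Submodule.span ℝ (Set.range v) := by
  have key : ∀ w : n → ℝ, (B ^ k).mulVec w = 0 →
      w ∈ End.maxGenEigenspace (Matrix.toLin' B) 0 := by
    intro w hw
    rw [End.mem_maxGenEigenspace]
    refine ⟨k, ?_⟩
    rw [zero_smul, sub_zero, ← Matrix.toLin'_pow, Matrix.toLin'_apply]
    exact hw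
  -- Inclusion plus equal dimension: the maximal generalized eigenspace has the algebraic
  -- multiplicity as its dimension.
  have hle : Submodule.span ℝ (Set.range v) ≤ End.maxGenEigenspace (Matrix.toLin' B) 0 :=
    Submodule.span_le.2 (by rintro _ ⟨i, rfl⟩; exact key _ (hv i))
  have hfin : finrank ℝ (Submodule.span ℝ (Set.range v)) =
      finrank ℝ (End.maxGenEigenspace (Matrix.toLin' B) 0) := by
    rw [finrank_span_eq_card hli, LinearMap.finrank_maxGenEigenspace_eq, Matrix.charpoly_toLin',
      Fintype.card_fin]
  rw [Submodule.eq_of_le_of_finrank_eq hle hfin]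
  exact key u hu

theorem linearIndependent_of_dotProduct_eq_ite {m : ℕ} {v w : Fin m → n → ℝ}
    (h : ∀ i j, w i ⬝ᵥ v j = if i = j then 1 else 0) : LinearIndependent ℝ v := by
  rw [Fintype.linearIndependent_iff]
  intro g hg i
  have := congrArg (fun x => w i ⬝ᵥ x) hg
  simpa [dotProduct_sum, dotProduct_smul, h] using this

theorem sum_dotProduct_smul_of_mem_span {m : ℕ} {v w : Fin m → n → ℝ}
    (h : ∀ i j, w i ⬝ᵥ v j = if i = j then 1 else 0) {u : n → ℝ}
    (hu : u ∈ Submodule.span ℝ (Set.range v)) : ∑ i, (w i ⬝ᵥ u) • v i = u := by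
  obtain ⟨c, rfl⟩ := (Submodule.mem_span_range_iff_exists_fun ℝ).1 hu
  simp [dotProduct_sum, dotProduct_smul, h]

end LinearAlgebra

/-! ### Dynamics of the synchronization error and the Lyapunov identity. -/

namespace SignedDigraph

open Matrix

variable {N : ℕ} {G : SignedDigraph N} {vr vl : Fin G.numZero → G.Edge → ℝ}

/-- The spectral projection onto the generalized null space commutes with the edge Laplacian. -/
theorem IsZeroEigenvectors.sum_dotProduct_mulVec (h : G.IsZeroEigenvectors vr vl)
    (u : G.Edge → ℝ) :
    ∑ i, (vl i ⬝ᵥ G.edgeLaplacian *ᵥ u) • vr i =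
      G.edgeLaplacian *ᵥ ∑ i, (vl i ⬝ᵥ u) • vr i := by
  have hsymm : ∀ i j, vr i ⬝ᵥ vl j = if i = j then 1 else 0 := fun i j => by
    rw [dotProduct_comm, h.normalized]; simp [eq_comm]
  -- `L` preserves its generalized null space, on which the projection is the identity.
  have hR : ∀ j, ∑ i, (vl i ⬝ᵥ G.edgeLaplacian *ᵥ vr j) • vr i = G.edgeLaplacian *ᵥ vr j := by
    intro j
    refine sum_dotProduct_smul_of_mem_span h.normalized
      (mem_span_of_pow_mulVec_eq_zero (k := Fintype.card G.Edge)
        (linearIndependent_of_dotProduct_eq_ite h.normalized) h.right ?_)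
    rw [mulVec_mulVec, (Commute.refl G.edgeLaplacian).pow_left _ |>.eq, ← mulVec_mulVec, h.right,
      mulVec_zero]
  -- The span lemma for `Lᵀ` expects a family indexed by the multiplicity for `Lᵀ`; the two index
  -- types agree only up to this equality, hence the cast.
  have hT : G.numZero = G.edgeLaplacianᵀ.charpoly.rootMultiplicity 0 := by
    rw [charpoly_transpose]; rfl
  have hL : ∀ i, ∑ j, (vr j ⬝ᵥ vl i ᵥ* G.edgeLaplacian) • vl j = vl i ᵥ* G.edgeLaplacian := by
    intro i
    refine sum_dotProduct_smul_of_mem_span hsymm ?_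
    have hs : Set.range vl = Set.range (vl ∘ Fin.cast hT.symm) :=
      ((finCongr hT.symm).surjective.range_comp vl).symm
    rw [hs]
    refine mem_span_of_pow_mulVec_eq_zero (B := G.edgeLaplacianᵀ) (k := Fintype.card G.Edge)
      ((linearIndependent_of_dotProduct_eq_ite hsymm).comp _ (Fin.cast_injective _)) ?_ ?_
    · intro j
      rw [← transpose_pow, mulVec_transpose]
      exact h.left _
    · rw [← transpose_pow, mulVec_transpose, vecMul_vecMul,
        ((Commute.refl G.edgeLaplacian).pow_right _).eq, ← vecMul_vecMul, h.left, zero_vecMul]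
  -- Left invariance expresses `vl_i L` through the `vl_j`, so both sides of the goal become the
  -- same double sum.
  have hL' : ∀ i, vl i ⬝ᵥ G.edgeLaplacian *ᵥ u =
      ∑ j, (vl i ⬝ᵥ G.edgeLaplacian *ᵥ vr j) * (vl j ⬝ᵥ u) := by
    intro i
    rw [dotProduct_mulVec, ← hL i, sum_dotProduct]
    refine Finset.sum_congr rfl fun j _ => ?_
    rw [smul_dotProduct, smul_eq_mul, dotProduct_comm (vr j), ← dotProduct_mulVec]
  rw [mulVec_sum]
  simp_rw [mulVec_smul, hL', Finset.sum_smul]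
  rw [Finset.sum_comm]
  refine Finset.sum_congr rfl fun j _ => ?_
  rw [← hR j, Finset.smul_sum]
  refine Finset.sum_congr rfl fun i _ => ?_
  rw [hR j, smul_smul, mul_comm]

theorem IsZeroEigenvectors.dotProduct_syncError (h : G.IsZeroEigenvectors vr vl)
    (x : Fin N → ℝ) (i : Fin G.numZero) : vl i ⬝ᵥ G.syncError vr vl x = 0 := by
  simp [syncError, dotProduct_sub, dotProduct_sum, dotProduct_smul, h.normalized]

/-- Edge states obey the linear law with matrix `-k₁ L`, and the projection commutes with `L`; the
error dynamics is therefore closed in the error alone. -/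
theorem IsZeroEigenvectors.syncError_control (h : G.IsZeroEigenvectors vr vl) (k₁ : ℝ)
    (x : Fin N → ℝ) :
    G.syncError vr vl (G.control k₁ x) = -(k₁ • G.edgeLaplacian *ᵥ G.syncError vr vl x) := by
  have he : G.edgeState (G.control k₁ x) = -(k₁ • G.edgeLaplacian *ᵥ G.edgeState x) := by
    simp only [edgeState, control, edgeLaplacian, mulVec_neg, mulVec_smul, mulVec_mulVec,
      Matrix.mul_assoc]
  rw [syncError, he, syncError, mulVec_sub, ← h.sum_dotProduct_mulVec]
  simp only [dotProduct_neg, dotProduct_smul, neg_smul, smul_assoc, Finset.sum_neg_distrib,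
    ← Finset.smul_sum, smul_sub]
  abel

/-- The synchronization error, as a continuous linear map. -/
def syncErrorCLM (vr vl : Fin G.numZero → G.Edge → ℝ) : (Fin N → ℝ) →L[ℝ] (G.Edge → ℝ) :=
  LinearMap.toContinuousLinearMap
    { toFun := G.syncError vr vl
      map_add' := fun x y => by
        simp only [syncError, edgeState, mulVec_add, dotProduct_add, add_smul,
          Finset.sum_add_distrib]
        abel
      map_smul' := fun c x => by
        simp [syncError, edgeState, mulVec_smul, dotProduct_smul, smul_sub, Finset.smul_sum,
          mul_smul] }

/-- On errors without a component along the zero eigenvectors the Lyapunov equation acts as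
`P L + Lᵀ P = I`. -/
theorem IsLyapunovMatrix.dotProduct_mulVec_mulVec {α : Fin G.numZero → ℝ}
    {P : Matrix G.Edge G.Edge ℝ} (hP : G.IsLyapunovMatrix vr vl α P) {e : G.Edge → ℝ}
    (he : ∀ i, vl i ⬝ᵥ e = 0) :
    2 * (e ⬝ᵥ P *ᵥ G.edgeLaplacian *ᵥ e) = e ⬝ᵥ e := by
  have hsymm : Pᵀ = P := by simpa using hP.posDef.isHermitian.eq
  have h1 : e ⬝ᵥ (P * G.edgeLaplacian + G.edgeLaplacianᵀ * P) *ᵥ e =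
      2 * (e ⬝ᵥ P *ᵥ G.edgeLaplacian *ᵥ e) := by
    have : e ⬝ᵥ (G.edgeLaplacianᵀ * P) *ᵥ e = e ⬝ᵥ (P * G.edgeLaplacian) *ᵥ e := by
      rw [dotProduct_comm, ← vecMul_transpose, transpose_mul, hsymm, transpose_transpose,
        ← dotProduct_mulVec]
    rw [add_mulVec, dotProduct_add, this, mulVec_mulVec]
    ring
  rw [← h1]
  by_cases ht : G.IsDirectedTree
  · rw [hP.tree ht, one_mulVec]
  · have hz : ∀ i, e ⬝ᵥ (α i • (P * vecMulVec (vr i) (vl i) + vecMulVec (vl i) (vr i) * P)) *ᵥ e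
        = 0 := by
      intro i
      have h2 : vecMulVec (vr i) (vl i) *ᵥ e = 0 := by
        rw [vecMulVec_mulVec, he]; simp
      have h3 : e ᵥ* vecMulVec (vl i) (vr i) = 0 := by
        rw [vecMul_vecMulVec, dotProduct_comm, he]; simp
      rw [smul_mulVec, add_mulVec, ← mulVec_mulVec, h2, dotProduct_smul, dotProduct_add,
        dotProduct_mulVec e (vecMulVec (vl i) (vr i) * P), ← vecMul_vecMul, h3]
      simp
    rw [hP.general ht, sub_mulVec, one_mulVec, dotProduct_sub, sum_mulVec, dotProduct_sum,
      Finset.sum_eq_zero fun i _ => hz i, sub_zero]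

end SignedDigraph

/-! ### Quadratic forms, extreme eigenvalues and selection matrices. -/

section Quadratic

open Matrix

variable {n : Type*} [Fintype n]

theorem euclNorm_sq (v : n → ℝ) : euclNorm v ^ 2 = v ⬝ᵥ v := by
  rw [euclNorm, EuclideanSpace.real_norm_sq_eq]
  simp [dotProduct, sq]

theorem euclNorm_nonneg (v : n → ℝ) : 0 ≤ euclNorm v := norm_nonneg _

/-- Shifting by a scalar shifts the spectrum, so `λ_max I - P` has nonnegative spectrum and is
positive semidefinite. -/
theorem dotProduct_mulVec_le_lambdaMax [DecidableEq n] {P : Matrix n n ℝ}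
    (hP : P.IsHermitian) (v : n → ℝ) :
    v ⬝ᵥ P *ᵥ v ≤ lambdaMax P * (v ⬝ᵥ v) := by
  have h : (algebraMap ℝ (Matrix n n ℝ) (lambdaMax P) - P).PosSemidef := by
    rw [posSemidef_iff_isHermitian_and_spectrum_nonneg]
    refine ⟨?_, ?_⟩
    · refine IsHermitian.sub ?_ hP
      rw [Algebra.algebraMap_eq_smul_one]
      simp [IsHermitian]
    · intro x hx
      rw [← spectrum.singleton_sub_eq] at hx
      obtain ⟨a, rfl, b, hb, rfl⟩ := hx
      exact sub_nonneg.2 (le_csSup (Matrix.finite_real_spectrum (A := P)).bddAbove hb)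
  have := h.dotProduct_mulVec_nonneg v
  rw [Algebra.algebraMap_eq_smul_one, sub_mulVec, smul_mulVec, one_mulVec, dotProduct_sub,
    dotProduct_smul] at this
  simpa using this

theorem lambdaMin_le_dotProduct_mulVec [DecidableEq n] {P : Matrix n n ℝ}
    (hP : P.IsHermitian) (v : n → ℝ) :
    lambdaMin P * (v ⬝ᵥ v) ≤ v ⬝ᵥ P *ᵥ v := by
  have h : (P - algebraMap ℝ (Matrix n n ℝ) (lambdaMin P)).PosSemidef := by
    rw [posSemidef_iff_isHermitian_and_spectrum_nonneg]
    refine ⟨?_, ?_⟩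
    · refine IsHermitian.sub hP ?_
      rw [Algebra.algebraMap_eq_smul_one]
      simp [IsHermitian]
    · intro x hx
      rw [← spectrum.sub_singleton_eq] at hx
      obtain ⟨b, hb, a, rfl, rfl⟩ := hx
      exact sub_nonneg.2 (csInf_le (Matrix.finite_real_spectrum (A := P)).bddBelow hb)
  have := h.dotProduct_mulVec_nonneg v
  rw [Algebra.algebraMap_eq_smul_one, sub_mulVec, smul_mulVec, one_mulVec, dotProduct_sub,
    dotProduct_smul] at this
  simpa using this

theorem Matrix.PosDef.lambdaMin_pos [DecidableEq n] [Nonempty n]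
    {P : Matrix n n ℝ} (hP : P.PosDef) :
    0 < lambdaMin P := by
  have hs := hP.isHermitian.spectrum_real_eq_range_eigenvalues
  have hne : (spectrum ℝ P).Nonempty := hs ▸ Set.range_nonempty _
  obtain ⟨i, hi⟩ := hs ▸ hne.csInf_mem (Matrix.finite_real_spectrum (A := P))
  rw [lambdaMin, hs, ← hi]
  exact hP.eigenvalues_pos i

theorem Matrix.PosDef.lambdaMax_pos [DecidableEq n] [Nonempty n]
    {P : Matrix n n ℝ} (hP : P.PosDef) :
    0 < lambdaMax P := by
  have hs := hP.isHermitian.spectrum_real_eq_range_eigenvalues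
  have hne : (spectrum ℝ P).Nonempty := hs ▸ Set.range_nonempty _
  obtain ⟨i, hi⟩ := hs ▸ hne.csSup_mem (Matrix.finite_real_spectrum (A := P))
  rw [lambdaMax, hs, ← hi]
  exact hP.eigenvalues_pos i

/-- Expansion of `(u - v)ᵀ P (u - v) ≥ 0`; this is the source of the factor `2` in `Ω`. -/
theorem Matrix.PosSemidef.dotProduct_mulVec_add_le {P : Matrix n n ℝ} (hP : P.PosSemidef)
    (u v : n → ℝ) :
    (u + v) ⬝ᵥ P *ᵥ (u + v) ≤ 2 * (u ⬝ᵥ P *ᵥ u) + 2 * (v ⬝ᵥ P *ᵥ v) := by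
  have h := hP.dotProduct_mulVec_nonneg (u - v)
  simp only [star_trivial, mulVec_sub, mulVec_add, dotProduct_sub, dotProduct_add,
    sub_dotProduct, add_dotProduct] at h ⊢
  linarith

/-- A selection matrix does not increase the Euclidean norm. -/
theorem IsSelectionMatrix.dotProduct_mulVec_self_le {m : Type*} [Fintype m] {X : Matrix m n ℝ}
    (hX : IsSelectionMatrix X) (v : n → ℝ) : X *ᵥ v ⬝ᵥ X *ᵥ v ≤ v ⬝ᵥ v := by
  classical
  -- A row picks at most one coordinate, so squaring commutes with the selection; column sums at
  -- most `1` then finish.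
  have hrow : ∀ i, (X *ᵥ v) i * (X *ᵥ v) i = ∑ j, X i j * (v j * v j) := by
    intro i
    by_cases h : ∃ j, X i j = 1
    · obtain ⟨j, hj⟩ := h
      have h0 : ∀ k, k ≠ j → X i k = 0 := fun k hk =>
        (hX.zero_or_one i k).resolve_right fun h1 => hk (hX.row i k j h1 hj)
      rw [mulVec, dotProduct, Finset.sum_eq_single j (fun k _ hk => by simp [h0 k hk]) (by simp),
        Finset.sum_eq_single j (fun k _ hk => by simp [h0 k hk]) (by simp), hj]
      ring
    · have h0 : ∀ k, X i k = 0 := fun k =>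
        (hX.zero_or_one i k).resolve_right fun h1 => h ⟨k, h1⟩
      simp [mulVec, dotProduct, h0]
  have hcol : ∀ j, ∑ i, X i j ≤ 1 := by
    intro j
    by_cases h : ∃ i, X i j = 1
    · obtain ⟨i, hi⟩ := h
      rw [Finset.sum_eq_single i (fun k _ hk => (hX.zero_or_one k j).resolve_right
        fun h1 => hk (hX.col k i j h1 hi)) (by simp), hi]
    · rw [Finset.sum_eq_zero fun k _ => (hX.zero_or_one k j).resolve_right fun h1 => h ⟨k, h1⟩]
      exact zero_le_one
  calc X *ᵥ v ⬝ᵥ X *ᵥ v = ∑ i, ∑ j, X i j * (v j * v j) := Finset.sum_congr rfl fun i _ => hrow i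
    _ = ∑ j, (∑ i, X i j) * (v j * v j) := by
        rw [Finset.sum_comm]; simp_rw [Finset.sum_mul]
    _ ≤ ∑ j, v j * v j := Finset.sum_le_sum fun j _ =>
        mul_le_of_le_one_left (mul_self_nonneg _) (hcol j)

end Quadratic

/-! ### Exponential decay between switchings. -/

section Flow

/-- The function `V t * exp (γ t)` has nonpositive derivative, hence is antitone on the interval. -/
theorem le_exp_mul_of_hasDerivWithinAt_le {s : Set ℝ} (hs : Convex ℝ s) {V V' : ℝ → ℝ} {γ : ℝ}
    (hV : ∀ t ∈ s, HasDerivWithinAt V (V' t) s t) (hle : ∀ t ∈ s, V' t ≤ -(γ * V t))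
    {a t : ℝ} (ha : a ∈ s) (ht : t ∈ s) (hat : a ≤ t) :
    V t ≤ Real.exp (-(γ * (t - a))) * V a := by
  have hd : ∀ r ∈ s, HasDerivWithinAt (fun r => V r * Real.exp (γ * r))
      (V' r * Real.exp (γ * r) + V r * (Real.exp (γ * r) * (γ * 1))) s r := fun r hr =>
    (hV r hr).mul ((((hasDerivAt_id r).const_mul γ).exp).hasDerivWithinAt)
  have hanti : AntitoneOn (fun r => V r * Real.exp (γ * r)) s := by
    refine antitoneOn_of_hasDerivWithinAt_nonpos hs (fun r hr => (hd r hr).continuousWithinAt)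
      (fun r hr => (hd r (interior_subset hr)).mono interior_subset) fun r hr => ?_
    have h1 := hle r (interior_subset hr)
    have h2 := Real.exp_pos (γ * r)
    nlinarith
  have h := hanti ha ht hat
  have h3 : Real.exp (-(γ * (t - a))) = Real.exp (γ * a) * Real.exp (-(γ * t)) := by
    rw [← Real.exp_add]; congr 1; ring
  calc V t = V t * Real.exp (γ * t) * Real.exp (-(γ * t)) := by
        rw [mul_assoc, ← Real.exp_add]; simp
    _ ≤ V a * Real.exp (γ * a) * Real.exp (-(γ * t)) :=
        mul_le_mul_of_nonneg_right h (Real.exp_pos _).le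
    _ = _ := by rw [h3]; ring

theorem SwitchingSignal.convex_closedPhase {Q : Type*} (S : SwitchingSignal Q) (l : ℕ) :
    Convex ℝ (S.closedPhase l) := by
  refine Set.OrdConnected.convex ⟨fun a ha b hb r hr => ?_⟩
  exact ⟨ha.1, ha.2.1.trans hr.1, fun h => hr.2.trans (hb.2.2 h)⟩

open Matrix in
theorem HasDerivWithinAt.dotProduct_mulVec_self {n : Type*} [Fintype n] {P : Matrix n n ℝ}
    (hP : Pᵀ = P) {e : ℝ → n → ℝ} {e' : n → ℝ} {s : Set ℝ} {t : ℝ}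
    (he : HasDerivWithinAt e e' s t) :
    HasDerivWithinAt (fun r => e r ⬝ᵥ P *ᵥ e r) (2 * (e t ⬝ᵥ P *ᵥ e')) s t := by
  have h1 := hasDerivWithinAt_pi.1 he
  have h2 : ∀ i, HasDerivWithinAt (fun r => (P *ᵥ e r) i) ((P *ᵥ e') i) s t := fun i => by
    simp only [mulVec, dotProduct]
    exact HasDerivWithinAt.fun_sum fun j _ => (h1 j).const_mul _
  have h3 : HasDerivWithinAt (fun r => e r ⬝ᵥ P *ᵥ e r)
      (∑ i, (e' i * (P *ᵥ e t) i + e t i * (P *ᵥ e') i)) s t := by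
    simp only [dotProduct]
    exact HasDerivWithinAt.fun_sum fun i _ => (h1 i).mul (h2 i)
  convert h3 using 1
  have h4 : e' ⬝ᵥ P *ᵥ e t = e t ⬝ᵥ P *ᵥ e' := by
    rw [dotProduct_comm, ← vecMul_transpose, hP, ← dotProduct_mulVec]
  rw [Finset.sum_add_distrib]
  change _ = e' ⬝ᵥ P *ᵥ e t + e t ⬝ᵥ P *ᵥ e'
  rw [h4]; ring

open Matrix in
/-- Exponential decay of the quadratic Lyapunov function of the synchronization errors. -/
theorem SignedDigraph.IsLyapunovMatrix.le_exp_mul {N : ℕ} {G : SignedDigraph N}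
    {vr vl : Fin G.numZero → G.Edge → ℝ} {α : Fin G.numZero → ℝ} {P : Matrix G.Edge G.Edge ℝ}
    (hP : G.IsLyapunovMatrix vr vl α P) (hv : G.IsZeroEigenvectors vr vl) {k₁ γ : ℝ}
    (hγ : ∀ e : G.Edge → ℝ, γ * (e ⬝ᵥ P *ᵥ e) ≤ k₁ * (e ⬝ᵥ e))
    {s : Set ℝ} (hs : Convex ℝ s) {x : ℝ → Fin N → ℝ}
    (hx : ∀ t ∈ s, HasDerivWithinAt x (G.control k₁ (x t)) s t) {a t : ℝ}
    (ha : a ∈ s) (ht : t ∈ s) (hat : a ≤ t) :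
    G.syncError vr vl (x t) ⬝ᵥ P *ᵥ G.syncError vr vl (x t) ≤
      Real.exp (-(γ * (t - a))) *
        (G.syncError vr vl (x a) ⬝ᵥ P *ᵥ G.syncError vr vl (x a)) := by
  have hsymm : Pᵀ = P := by simpa using hP.posDef.isHermitian.eq
  have he : ∀ r ∈ s, HasDerivWithinAt (fun r => G.syncError vr vl (x r))
      (G.syncError vr vl (G.control k₁ (x r))) s r := fun r hr =>
    (syncErrorCLM vr vl).hasFDerivAt.comp_hasDerivWithinAt r (hx r hr)
  refine le_exp_mul_of_hasDerivWithinAt_le hs (V := fun r =>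
    G.syncError vr vl (x r) ⬝ᵥ P *ᵥ G.syncError vr vl (x r))
    (fun r hr => (he r hr).dotProduct_mulVec_self hsymm) (fun r _ => ?_) ha ht hat
  have h1 := hP.dotProduct_mulVec_mulVec (hv.dotProduct_syncError (x r))
  have h2 := hγ (G.syncError vr vl (x r))
  rw [hv.syncError_control, mulVec_neg, dotProduct_neg, mulVec_smul, dotProduct_smul, smul_eq_mul]
  rw [← h1] at h2
  linarith

end Flow

/-! ### Counting switchings against active durations. -/

namespace SwitchingSignal

variable {Q : Type*} (S : SwitchingSignal Q)

theorem time_le_time {i j : ℕ} (hij : i ≤ j) (hj : (j : ℕ∞) ≤ S.numSwitches) :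
    S.time i ≤ S.time j := by
  induction j, hij using Nat.le_induction with
  | base => exact le_rfl
  | succ j _ ih =>
    exact (ih (le_trans (by exact_mod_cast Nat.le_succ j) hj)).trans (S.time_lt j hj).le

variable {S} in
theorem le_of_mem_phase {i l : ℕ} {r t : ℝ} (hr : r ∈ S.phase i) (ht : t ∈ S.phase l)
    (hrt : r ≤ t) : i ≤ l := by
  by_contra! h
  have h1 : ((l + 1 : ℕ) : ℕ∞) ≤ S.numSwitches :=
    le_trans (by exact_mod_cast h) hr.1
  have h2 := S.time_le_time h hr.1
  linarith [ht.2.2 h1, hr.2.1]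

theorem time_mem_phase {l : ℕ} (hl : (l : ℕ∞) ≤ S.numSwitches) : S.time l ∈ S.phase l :=
  ⟨hl, le_rfl, fun h => S.time_lt l h⟩

/-- The starting times of the phases up to the `l`-th, and then `t`. -/
def truncTime (l : ℕ) (t : ℝ) (i : ℕ) : ℝ := if i ≤ l then S.time i else t

variable {S}

theorem truncTime_le_succ {l : ℕ} {t : ℝ} (ht : t ∈ S.phase l) {i : ℕ} (hi : i ≤ l) :
    S.truncTime l t i ≤ S.truncTime l t (i + 1) := by
  rw [truncTime, if_pos hi, truncTime]
  split_ifs with h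
  · exact S.time_le_time (Nat.le_succ i) (le_trans (by exact_mod_cast h) ht.1)
  · exact (S.time_le_time hi ht.1).trans ht.2.1

/-- The active set is covered by the phases `i + 1` with the given transition, the last one cut off
at `t`; subadditivity of the measure suffices. -/
theorem activeDuration_le [DecidableEq Q] {j l : ℕ} {t : ℝ} (hj : j < l) (ht : t ∈ S.phase l)
    (φ φ' : Q) :
    S.activeDuration φ φ' (S.time (j + 1)) t ≤
      ∑ i ∈ Finset.Ico j l with (S.mode (i + 1), S.mode i) = (φ, φ'),
        (S.truncTime l t (i + 2) - S.truncTime l t (i + 1)) := by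
  set F := {i ∈ Finset.Ico j l | (S.mode (i + 1), S.mode i) = (φ, φ')} with hF
  have hnn : ∀ i ∈ F, 0 ≤ S.truncTime l t (i + 2) - S.truncTime l t (i + 1) := fun i hi => by
    have : i < l := (Finset.mem_Ico.1 (Finset.mem_filter.1 hi).1).2
    exact sub_nonneg.2 (truncTime_le_succ ht this)
  have hsub : {r : ℝ | r ∈ Set.Ico (S.time (j + 1)) t ∧
      ∃ i : ℕ, r ∈ S.phase (i + 1) ∧ S.mode i = φ' ∧ S.mode (i + 1) = φ} ⊆
      ⋃ i ∈ F, Set.Icc (S.truncTime l t (i + 1)) (S.truncTime l t (i + 2)) := by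
    rintro r ⟨⟨hr1, hr2⟩, i, hi, h1, h2⟩
    have hil : i + 1 ≤ l := le_of_mem_phase hi ht hr2.le
    have hji : j + 1 ≤ i + 1 := le_of_mem_phase
      (S.time_mem_phase (le_trans (by exact_mod_cast hj) ht.1)) hi hr1
    have hiF : i ∈ F := by
      rw [hF, Finset.mem_filter, Finset.mem_Ico, h1, h2]
      exact ⟨⟨by omega, by omega⟩, rfl⟩
    refine Set.mem_biUnion hiF ⟨?_, ?_⟩
    · rw [truncTime, if_pos hil]; exact hi.2.1
    · rw [truncTime]
      split_ifs with h
      · exact (hi.2.2 (le_trans (by exact_mod_cast h) ht.1)).le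
      · exact hr2.le
  refine ENNReal.toReal_le_of_le_ofReal (Finset.sum_nonneg hnn) ?_
  calc _ ≤ volume (⋃ i ∈ F, Set.Icc (S.truncTime l t (i + 1)) (S.truncTime l t (i + 2))) :=
        measure_mono hsub
    _ ≤ ∑ i ∈ F, volume (Set.Icc (S.truncTime l t (i + 1)) (S.truncTime l t (i + 2))) :=
        measure_biUnion_finset_le _ _
    _ = _ := by
        rw [ENNReal.ofReal_sum_of_nonneg hnn]
        simp only [Real.volume_Icc]

/-- Transition `i` takes place at `time (i + 1)`. The last one, `i = l - 1`, is left out because it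
may occur at `t` itself, outside the half-open window. -/
theorem card_le_switchCount [DecidableEq Q] {j l : ℕ} {t : ℝ} (ht : t ∈ S.phase l) (φ φ' : Q) :
    Finset.card {i ∈ Finset.Ico j (l - 1) | (S.mode (i + 1), S.mode i) = (φ, φ')} ≤
      S.switchCount φ φ' (S.time (j + 1)) t := by
  rw [← Set.ncard_coe_finset]
  refine Set.ncard_le_ncard ?_ ?_
  · intro i hi
    simp only [Finset.coe_filter, Finset.mem_Ico, Prod.mk.injEq, Set.mem_ofPred_eq] at hi
    obtain ⟨⟨h1, h2⟩, h3, h4⟩ := hi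
    have hl : i + 2 ≤ l := by omega
    have hn : ((i + 2 : ℕ) : ℕ∞) ≤ S.numSwitches := le_trans (by exact_mod_cast hl) ht.1
    have hn' : ((i + 1 : ℕ) : ℕ∞) ≤ S.numSwitches :=
      le_trans (by exact_mod_cast Nat.le_succ (i + 1)) hn
    refine ⟨hn', ⟨S.time_le_time (by omega) hn', ?_⟩, h4, h3⟩
    exact (S.time_lt (i + 1) hn).trans_le ((S.time_le_time hl ht.1).trans ht.2.1)
  · refine (Set.finite_Iio l).subset fun i hi => ?_
    obtain ⟨hn, hI, -⟩ := hi
    exact le_of_mem_phase (S.time_mem_phase hn) ht hI.2.le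

variable [Fintype Q] {Nhat τ m : Q → Q → ℝ} {γ : Q → ℝ} {δ : ℝ}

/-- The average dwell time makes the decay during the phases dominate the growth at the
switchings. -/
theorem HasAverageDwellTime.sum_sub_le (hS : S.HasAverageDwellTime Nhat τ)
    (hNhat : ∀ φ φ', 0 ≤ Nhat φ φ') (hτ : ∀ φ φ', 0 < τ φ φ') (hm : ∀ φ φ', 0 ≤ m φ φ')
    (hγ : ∀ φ φ', m φ φ' / τ φ φ' ≤ γ φ - δ) {j l : ℕ} (hjl : j ≤ l) {t : ℝ}
    (ht : t ∈ S.phase l) :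
    ∑ i ∈ Finset.Ico j l, (m (S.mode (i + 1)) (S.mode i) -
        γ (S.mode i) * (S.time (i + 1) - S.time i)) - γ (S.mode l) * (t - S.time l) ≤
      ∑ q : Q × Q, m q.1 q.2 * (1 + Nhat q.1 q.2) - δ * (t - S.time j) := by
  classical
  have hγδ : ∀ φ, δ ≤ γ φ := fun φ => by
    linarith [hγ φ φ, div_nonneg (hm φ φ) (hτ φ φ).le]
  have hK : ∀ q : Q × Q, 0 ≤ m q.1 q.2 * (1 + Nhat q.1 q.2) := fun q =>
    mul_nonneg (hm _ _) (by linarith [hNhat q.1 q.2])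
  rcases hjl.eq_or_lt with rfl | hlt
  · have h1 := mul_le_mul_of_nonneg_right (hγδ (S.mode j)) (sub_nonneg.2 ht.2.1)
    have h2 := Finset.sum_nonneg fun q (_ : q ∈ Finset.univ) => hK q
    simp only [Finset.Ico_self, Finset.sum_empty]
    linarith
  have hj1 : ((j + 1 : ℕ) : ℕ∞) ≤ S.numSwitches := le_trans (by exact_mod_cast hlt) ht.1
  have hst : S.time (j + 1) ≤ t := (S.time_le_time hlt ht.1).trans ht.2.1
  have hADT : ∀ φ φ', (S.switchCount φ φ' (S.time (j + 1)) t : ℝ) ≤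
      Nhat φ φ' + S.activeDuration φ φ' (S.time (j + 1)) t / τ φ φ' := by
    intro φ φ'
    -- For `t = time (j + 1)` the window is empty and the dwell time hypothesis is silent, but count
    -- and duration both vanish.
    rcases hst.eq_or_lt with h | h
    · simpa [switchCount, activeDuration, h] using hNhat φ φ'
    · exact hS φ φ' _ _ (S.time_le_time (Nat.zero_le _) hj1) h
  set D : ℕ → ℝ := fun i => S.truncTime l t (i + 1) - S.truncTime l t i with hD
  have hDnn : ∀ i ∈ Finset.Ico j l, 0 ≤ D (i + 1) := fun i hi =>
    sub_nonneg.2 (truncTime_le_succ ht (Finset.mem_Ico.1 hi).2)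
  have hDi : ∀ i < l, D i = S.time (i + 1) - S.time i := fun i hi => by
    simp only [hD, truncTime]
    rw [if_pos (Nat.succ_le_of_lt hi), if_pos hi.le]
  have hDl : D l = t - S.time l := by simp [hD, truncTime]
  have hsumD : D j + ∑ i ∈ Finset.Ico j l, D (i + 1) = t - S.time j := by
    have h1 : ∑ i ∈ Finset.Ico j (l + 1), D i = S.truncTime l t (l + 1) - S.truncTime l t j :=
      Finset.sum_Ico_sub _ (by omega)
    rw [Finset.sum_eq_sum_Ico_succ_bot (by omega), ← Finset.sum_Ico_add' D j l 1] at h1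
    rw [h1]
    simp [truncTime, hjl]
  -- Phase `j` is split off: its predecessor lies outside the window, so its decay pays for no
  -- switching. Phase `i + 1` is paired with transition `i`.
  have hshift : ∑ i ∈ Finset.Ico j l, γ (S.mode i) * (S.time (i + 1) - S.time i) +
      γ (S.mode l) * (t - S.time l) =
      γ (S.mode j) * D j + ∑ i ∈ Finset.Ico j l, γ (S.mode (i + 1)) * D (i + 1) := by
    have h1 : ∑ i ∈ Finset.Ico j l, γ (S.mode i) * (S.time (i + 1) - S.time i) =
        ∑ i ∈ Finset.Ico j l, γ (S.mode i) * D i :=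
      Finset.sum_congr rfl fun i hi => by rw [hDi i (Finset.mem_Ico.1 hi).2]
    rw [h1, ← hDl, ← Finset.sum_Ico_succ_top hjl, Finset.sum_eq_sum_Ico_succ_bot (by omega),
      ← Finset.sum_Ico_add' (fun i => γ (S.mode i) * D i) j l 1]
  have hfib : ∀ (F : Finset ℕ) (f : Q → Q → ℝ) (w : ℕ → ℝ),
      ∑ i ∈ F, f (S.mode (i + 1)) (S.mode i) * w i =
        ∑ q : Q × Q, f q.1 q.2 * ∑ i ∈ F with (S.mode (i + 1), S.mode i) = (q.1, q.2), w i := by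
    intro F f w
    rw [← Finset.sum_fiberwise F (fun i => (S.mode (i + 1), S.mode i))]
    refine Finset.sum_congr rfl fun q _ => ?_
    rw [Finset.mul_sum]
    refine Finset.sum_congr rfl fun i hi => ?_
    obtain ⟨h1, h2⟩ := Prod.mk.inj (Finset.mem_filter.1 hi).2
    rw [h1, h2]
  -- The transition missed by the half-open count costs at most the sum of all `m`; this is the `1`
  -- in `1 + Nhat`.
  have hlast : m (S.mode (l - 1 + 1)) (S.mode (l - 1)) ≤ ∑ q : Q × Q, m q.1 q.2 :=
    Finset.single_le_sum (f := fun q : Q × Q => m q.1 q.2) (fun q _ => hm q.1 q.2)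
      (Finset.mem_univ (S.mode (l - 1 + 1), S.mode (l - 1)))
  have hcount : ∑ i ∈ Finset.Ico j (l - 1), m (S.mode (i + 1)) (S.mode i) ≤
      ∑ q : Q × Q, m q.1 q.2 * Nhat q.1 q.2 +
        ∑ i ∈ Finset.Ico j l, m (S.mode (i + 1)) (S.mode i) / τ (S.mode (i + 1)) (S.mode i) *
          D (i + 1) := by
    have h1 := hfib (Finset.Ico j (l - 1)) m (fun _ => 1)
    simp only [mul_one, Finset.sum_const, nsmul_eq_mul] at h1
    rw [h1, hfib (Finset.Ico j l) (fun φ φ' => m φ φ' / τ φ φ') (fun i => D (i + 1)),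
      ← Finset.sum_add_distrib]
    refine Finset.sum_le_sum fun q _ => ?_
    have h2 : (Finset.card {i ∈ Finset.Ico j (l - 1) |
        (S.mode (i + 1), S.mode i) = (q.1, q.2)} : ℝ) ≤
        S.switchCount q.1 q.2 (S.time (j + 1)) t := by exact_mod_cast card_le_switchCount ht _ _
    calc _ ≤ m q.1 q.2 * (Nhat q.1 q.2 +
          S.activeDuration q.1 q.2 (S.time (j + 1)) t / τ q.1 q.2) :=
          mul_le_mul_of_nonneg_left (h2.trans (hADT _ _)) (hm _ _)
      _ = m q.1 q.2 * Nhat q.1 q.2 +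
          m q.1 q.2 / τ q.1 q.2 * S.activeDuration q.1 q.2 (S.time (j + 1)) t := by ring
      _ ≤ _ := by
          have := mul_le_mul_of_nonneg_left (activeDuration_le hlt ht q.1 q.2)
            (div_nonneg (hm q.1 q.2) (hτ q.1 q.2).le)
          linarith
  have hdecay : ∑ i ∈ Finset.Ico j l,
      m (S.mode (i + 1)) (S.mode i) / τ (S.mode (i + 1)) (S.mode i) * D (i + 1) ≤
      ∑ i ∈ Finset.Ico j l, γ (S.mode (i + 1)) * D (i + 1) -
        δ * ∑ i ∈ Finset.Ico j l, D (i + 1) := by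
    rw [Finset.mul_sum, ← Finset.sum_sub_distrib]
    refine Finset.sum_le_sum fun i hi => ?_
    rw [← sub_mul]
    exact mul_le_mul_of_nonneg_right (hγ _ _) (hDnn i hi)
  have hDj : δ * D j ≤ γ (S.mode j) * D j :=
    mul_le_mul_of_nonneg_right (hγδ _) (sub_nonneg.2 (truncTime_le_succ ht hjl))
  have hsplit : ∑ i ∈ Finset.Ico j l, m (S.mode (i + 1)) (S.mode i) =
      ∑ i ∈ Finset.Ico j (l - 1), m (S.mode (i + 1)) (S.mode i) +
        m (S.mode (l - 1 + 1)) (S.mode (l - 1)) := by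
    rw [← Finset.sum_Ico_succ_top (by omega), Nat.sub_add_cancel (by omega)]
  have hKsum : ∑ q : Q × Q, m q.1 q.2 * (1 + Nhat q.1 q.2) =
      ∑ q : Q × Q, m q.1 q.2 + ∑ q : Q × Q, m q.1 q.2 * Nhat q.1 q.2 := by
    rw [← Finset.sum_add_distrib]
    exact Finset.sum_congr rfl fun q _ => by ring
  rw [Finset.sum_sub_distrib, hsplit, hKsum, ← hsumD, mul_add]
  linarith

/-- Multiple Lyapunov functions under a transition-dependent average dwell time, with jumps that
are controlled down to the level `c` only. -/
theorem HasAverageDwellTime.lyapunov_le (hS : S.HasAverageDwellTime Nhat τ)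
    (hNhat : ∀ φ φ', 0 ≤ Nhat φ φ') (hτ : ∀ φ φ', 0 < τ φ φ') (hm : ∀ φ φ', 0 ≤ m φ φ')
    (hδ : 0 ≤ δ) (hγ : ∀ φ φ', m φ φ' / τ φ φ' ≤ γ φ - δ) {V : ℕ → ℝ → ℝ} {c : ℝ} (hc : 0 ≤ c)
    (hV : 0 ≤ V 0 (S.time 0))
    (hflow : ∀ l, ∀ t ∈ S.closedPhase l,
      V l t ≤ Real.exp (-(γ (S.mode l) * (t - S.time l))) * V l (S.time l))
    (hjump : ∀ l : ℕ, ((l + 1 : ℕ) : ℕ∞) ≤ S.numSwitches → V (l + 1) (S.time (l + 1)) ≤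
      Real.exp (m (S.mode (l + 1)) (S.mode l)) * max (V l (S.time (l + 1))) c)
    {l : ℕ} {t : ℝ} (ht : t ∈ S.phase l) :
    V l t ≤ Real.exp (∑ q : Q × Q, m q.1 q.2 * (1 + Nhat q.1 q.2) - δ * (t - S.time 0)) *
        V 0 (S.time 0) +
      Real.exp (∑ q : Q × Q, m q.1 q.2 * (1 + Nhat q.1 q.2) + ∑ q : Q × Q, m q.1 q.2) * c := by
  set E : ℕ → ℕ → ℝ := fun j l => ∑ i ∈ Finset.Ico j l, (m (S.mode (i + 1)) (S.mode i) -
        γ (S.mode i) * (S.time (i + 1) - S.time i)) with hE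
  set M : ℝ := ∑ q : Q × Q, m q.1 q.2 with hM
  have hmM : ∀ φ φ', m φ φ' ≤ M := fun φ φ' =>
    Finset.single_le_sum (f := fun q : Q × Q => m q.1 q.2) (fun q _ => hm q.1 q.2)
      (Finset.mem_univ (φ, φ'))
  -- The index `j` in the second alternative is the latest phase entered from a value at most `c`;
  -- the factor `exp M` covers the jump into it.
  have key : ∀ l : ℕ, (l : ℕ∞) ≤ S.numSwitches →
      V l (S.time l) ≤ Real.exp (E 0 l) * V 0 (S.time 0) ∨
      ∃ j ≤ l, V l (S.time l) ≤ Real.exp (E j l) * (Real.exp M * c) := by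
    intro l
    induction l with
    | zero => intro _; left; simp [hE]
    | succ l ih =>
      intro hl
      have hl' : (l : ℕ∞) ≤ S.numSwitches := le_trans (by exact_mod_cast Nat.le_succ l) hl
      have hlt := S.time_lt l hl
      have hstep : ∀ j ≤ l, ∀ b, V l (S.time l) ≤ Real.exp (E j l) * b →
          Real.exp (m (S.mode (l + 1)) (S.mode l)) * V l (S.time (l + 1)) ≤
            Real.exp (E j (l + 1)) * b := by
        intro j hj b hb
        have h1 := (hflow l _ ⟨hl', hlt.le, fun _ => le_rfl⟩).trans
          (mul_le_mul_of_nonneg_left hb (Real.exp_pos _).le)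
        refine (mul_le_mul_of_nonneg_left h1 (Real.exp_pos _).le).trans_eq ?_
        rw [← mul_assoc, ← mul_assoc, ← Real.exp_add, ← Real.exp_add]
        congr 2
        simp only [hE]
        rw [Finset.sum_Ico_succ_top hj]
        ring
      have hj := hjump l hl
      rcases le_total (V l (S.time (l + 1))) c with h | h
      · rw [max_eq_right h] at hj
        refine Or.inr ⟨l + 1, le_rfl, hj.trans ?_⟩
        simpa [hE] using mul_le_mul_of_nonneg_right (Real.exp_le_exp.2 (hmM _ _)) hc
      · rw [max_eq_left h] at hj
        rcases ih hl' with h0 | ⟨j, hjl, hjV⟩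
        · exact Or.inl (hj.trans (hstep 0 (Nat.zero_le _) _ h0))
        · exact Or.inr ⟨j, hjl.trans (Nat.le_succ l), hj.trans (hstep j hjl _ hjV)⟩
  have hVt := hflow l t ⟨ht.1, ht.2.1, fun h => (ht.2.2 h).le⟩
  have hexp : ∀ j ≤ l, ∀ b, 0 ≤ b → V l (S.time l) ≤ Real.exp (E j l) * b →
      V l t ≤ Real.exp (∑ q : Q × Q, m q.1 q.2 * (1 + Nhat q.1 q.2) - δ * (t - S.time j)) * b := by
    intro j hj b hb h
    refine (hVt.trans (mul_le_mul_of_nonneg_left h (Real.exp_pos _).le)).trans ?_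
    rw [← mul_assoc, ← Real.exp_add]
    refine mul_le_mul_of_nonneg_right (Real.exp_le_exp.2 ?_) hb
    linarith [hS.sum_sub_le hNhat hτ hm hγ hj ht]
  rcases key l ht.1 with h | ⟨j, hj, h⟩
  · exact (hexp 0 (Nat.zero_le _) _ hV h).trans (le_add_of_nonneg_right (by positivity))
  · refine (hexp j hj _ (by positivity) h).trans ((?_ : _ ≤ _).trans
      (le_add_of_nonneg_left (by positivity)))
    rw [← mul_assoc, ← Real.exp_add]
    refine mul_le_mul_of_nonneg_right (Real.exp_le_exp.2 ?_) hc
    have := mul_nonneg hδ (sub_nonneg.2 ((S.time_le_time hj ht.1).trans ht.2.1))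
    linarith

end SwitchingSignal

/-! ### Jump estimates, the strict margin and the comparison function. -/

theorem exists_pos_forall_le {ι : Type*} [Finite ι] {f : ι → ℝ} (hf : ∀ i, 0 < f i) :
    ∃ a, 0 < a ∧ ∀ i, a ≤ f i := by
  rcases isEmpty_or_nonempty ι with h | h
  · exact ⟨1, one_pos, fun i => h.elim i⟩
  · obtain ⟨i, hi⟩ := Finite.exists_min f
    exact ⟨f i, hf i, hi⟩

theorem lambdaMax_of_isEmpty {n : Type*} [Fintype n] [DecidableEq n] [IsEmpty n]
    (P : Matrix n n ℝ) : lambdaMax P = 0 := by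
  rw [lambdaMax, spectrum.of_subsingleton, Real.sSup_empty]

theorem Matrix.PosDef.lambdaMax_nonneg {n : Type*} [Fintype n] [DecidableEq n]
    {P : Matrix n n ℝ} (hP : P.PosDef) : 0 ≤ lambdaMax P := by
  rcases isEmpty_or_nonempty n with h | h
  · exact (lambdaMax_of_isEmpty P).ge
  · exact hP.lambdaMax_pos.le

open Matrix in
/-- The growth of the quadratic Lyapunov functions at a switching. -/
theorem dotProduct_mulVec_jump_le {m n : Type*} [Fintype m] [DecidableEq m] [Fintype n]
    [DecidableEq n] {P : Matrix m m ℝ} {P' : Matrix n n ℝ} (hP : P.PosDef) (hP' : P'.PosDef)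
    {X : Matrix m n ℝ} (hX : IsSelectionMatrix X) (e : n → ℝ) (d : m → ℝ) :
    (X *ᵥ e + d) ⬝ᵥ P *ᵥ (X *ᵥ e + d) ≤
      2 * (lambdaMax P / lambdaMin P') * (e ⬝ᵥ P' *ᵥ e) + 2 * lambdaMax P * (d ⬝ᵥ d) := by
  have h0 := hP.lambdaMax_nonneg
  have h1 := hP.posSemidef.dotProduct_mulVec_add_le (X *ᵥ e) d
  have h2 := dotProduct_mulVec_le_lambdaMax hP.isHermitian (X *ᵥ e)
  have h3 := dotProduct_mulVec_le_lambdaMax hP.isHermitian d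
  have h4 := mul_le_mul_of_nonneg_left (hX.dotProduct_mulVec_self_le e) h0
  have h5 : lambdaMax P * (e ⬝ᵥ e) ≤ lambdaMax P / lambdaMin P' * (e ⬝ᵥ P' *ᵥ e) := by
    rcases isEmpty_or_nonempty n with h | h
    · simp [dotProduct]
    · have h6 := hP'.lambdaMin_pos
      rw [div_mul_eq_mul_div, mul_div_assoc]
      refine mul_le_mul_of_nonneg_left ?_ h0
      rw [le_div_iff₀ h6, mul_comm]
      exact lambdaMin_le_dotProduct_mulVec hP'.isHermitian e
  linarith

/-- An affine growth bound, above the level `2 * c`, with a factor below `1 + μ`. -/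
theorem mul_add_le_max_mul_max {μ v c : ℝ} (hμ : 0 ≤ μ) (hc : 0 ≤ c) :
    μ * v + c ≤ max 1 (μ + 1 / 2) * max v (2 * c) := by
  have h1 : μ * v ≤ μ * max v (2 * c) := mul_le_mul_of_nonneg_left (le_max_left _ _) hμ
  have h2 : 2 * c ≤ max v (2 * c) := le_max_right _ _
  have h3 := mul_le_mul_of_nonneg_right (le_max_right 1 (μ + 1 / 2))
    ((by linarith : 0 ≤ 2 * c).trans h2)
  linarith

/-- Strictness has two sources: `log 1 = 0 < γ τ` if the maximum is `1`, and `μ + 1/2 < 1 + μ`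
otherwise. -/
theorem log_max_one_add_half_lt {μ γ τ : ℝ} (hμ : 0 ≤ μ) (hγ : 0 < γ) (hτ : 0 < τ)
    (h : Real.log (1 + μ) / γ ≤ τ) : Real.log (max 1 (μ + 1 / 2)) < γ * τ := by
  rw [div_le_iff₀' hγ] at h
  rcases max_choice 1 (μ + 1 / 2) with hm | hm <;> rw [hm]
  · rw [Real.log_one]; positivity
  · exact (Real.log_lt_log (by linarith) (by linarith)).trans_le h

theorem le_sqrt_mul_add_sqrt {x A B r s : ℝ} (hA : 0 ≤ A) (hB : 0 ≤ B) (hr : 0 ≤ r)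
    (h : x ^ 2 ≤ A * Real.exp (-(s + s)) * r ^ 2 + B) :
    x ≤ Real.sqrt A * r * Real.exp (-s) + Real.sqrt B := by
  refine le_of_sq_le_sq (h.trans ?_) (by positivity)
  have h1 : Real.exp (-(s + s)) = Real.exp (-s) ^ 2 := by
    rw [sq, ← Real.exp_add]; congr 1; ring
  have h2 : 0 ≤ Real.sqrt A * r * Real.exp (-s) * Real.sqrt B := by positivity
  rw [add_sq, mul_pow, mul_pow, Real.sq_sqrt hA, Real.sq_sqrt hB, h1]
  linarith

theorem isClassKL_mul_exp {A δ : ℝ} (hA : 0 < A) (hδ : 0 < δ) :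
    IsClassKL fun r t => A * r * Real.exp (-(δ * t)) where
  continuousOn := by fun_prop
  classK := fun t _ =>
    { continuousOn := by fun_prop
      strictMonoOn := fun a _ b _ hab => by
        have := Real.exp_pos (-(δ * t))
        dsimp only
        gcongr
      zero := by simp }
  antitoneOn := fun r hr a _ b _ hab => by
    dsimp only
    gcongr
  tendsto_zero := fun r _ => by
    have h : Tendsto (fun t : ℝ => Real.exp (-(δ * t))) atTop (𝓝 0) :=
      Real.tendsto_exp_neg_atTop_nhds_zero.comp (tendsto_id.const_mul_atTop hδ)
    simpa using h.const_mul (A * r)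

/-! ### Choice of constants and conclusion. -/

open Matrix in
theorem theorem5 {Q : Type*} [Finite Q] {N : Q → ℕ} (G : ∀ φ, SignedDigraph (N φ))
    (k₁ : ℝ) (hk₁ : 0 < k₁)
    (vr vl : ∀ φ, Fin (G φ).numZero → (G φ).Edge → ℝ)
    (hv : ∀ φ, (G φ).IsZeroEigenvectors (vr φ) (vl φ))
    (α : ∀ φ, Fin (G φ).numZero → ℝ) (hα : ∀ φ i, 0 < α φ i)
    (P : ∀ φ, Matrix (G φ).Edge (G φ).Edge ℝ)
    (hP : ∀ φ, (G φ).IsLyapunovMatrix (vr φ) (vl φ) (α φ) (P φ))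
    (Ξ : ∀ φ φ', Matrix (G φ).Edge (G φ').Edge ℝ)
    (hΞ : ∀ φ φ', IsSelectionMatrix (Ξ φ φ'))
    (Φbar : ℝ)
    (Nhat τ : Q → Q → ℝ) (hNhat : ∀ φ φ', 0 ≤ Nhat φ φ') (hτ_pos : ∀ φ φ', 0 < τ φ φ')
    (hτ : ∀ φ φ', Real.log (1 + 2 * (lambdaMax (P φ) / lambdaMin (P φ'))) /
      (k₁ * (1 / lambdaMax (P φ))) ≤ τ φ φ') :
    IsGloballyUniformlyPracticallyStable G k₁ vr vl Ξ Φbar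
      {S | (G (S.mode 0)).ContainsDirectedSpanningTree ∧ S.HasAverageDwellTime Nhat τ} := by
  classical
  have := Fintype.ofFinite Q
  have hpd : ∀ φ, (P φ).PosDef := fun φ => (hP φ).posDef
  have hmax : ∀ φ, 0 ≤ lambdaMax (P φ) := fun φ => (hpd φ).lambdaMax_nonneg
  set μ : Q → Q → ℝ := fun φ φ' => 2 * (lambdaMax (P φ) / lambdaMin (P φ')) with hμ_def
  have hμ : ∀ φ φ', 0 ≤ μ φ φ' := by
    intro φ φ'
    have hmin : 0 ≤ lambdaMin (P φ') := by
      rcases isEmpty_or_nonempty (G φ').Edge with h | h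
      · rw [lambdaMin, spectrum.of_subsingleton, Real.sInf_empty]
      · exact (hpd φ').lambdaMin_pos.le
    exact mul_nonneg two_pos.le (div_nonneg (hmax φ) hmin)
  set m : Q → Q → ℝ := fun φ φ' => Real.log (max 1 (μ φ φ' + 1 / 2)) with hm_def
  have hm : ∀ φ φ', 0 ≤ m φ φ' := fun φ φ' => Real.log_nonneg (le_max_left _ _)
  have hexp_m : ∀ φ φ', Real.exp (m φ φ') = max 1 (μ φ φ' + 1 / 2) := fun φ φ' =>
    Real.exp_log (lt_max_of_lt_left one_pos)
  obtain ⟨γ, hγ, hγτ⟩ : ∃ γ : Q → ℝ,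
      (∀ φ, ∀ e : (G φ).Edge → ℝ, γ φ * (e ⬝ᵥ P φ *ᵥ e) ≤ k₁ * (e ⬝ᵥ e)) ∧
      ∀ φ φ', m φ φ' < γ φ * τ φ φ' := by
    have h : ∀ φ, ∃ γ : ℝ, (∀ e : (G φ).Edge → ℝ, γ * (e ⬝ᵥ P φ *ᵥ e) ≤ k₁ * (e ⬝ᵥ e)) ∧
        ∀ φ', m φ φ' < γ * τ φ φ' := by
      intro φ
      -- Without edges `lambdaMax` is `sSup ∅ = 0`, and the formula for the rate gives `0`. The form
      -- vanishes there, so the rate `1` is admissible; also `m = log 1 = 0`.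
      rcases isEmpty_or_nonempty (G φ).Edge with h | h
      · refine ⟨1, fun e => by simp [dotProduct], fun φ' => ?_⟩
        have h0 : m φ φ' = 0 := by
          simp only [hm_def, hμ_def, lambdaMax_of_isEmpty]
          norm_num
        rw [h0, one_mul]
        exact hτ_pos φ φ'
      · have hpos := (hpd φ).lambdaMax_pos
        refine ⟨k₁ * (1 / lambdaMax (P φ)), fun e => ?_, fun φ' =>
          log_max_one_add_half_lt (hμ φ φ') (by positivity) (hτ_pos φ φ') (hτ φ φ')⟩
        rw [mul_assoc, one_div, inv_mul_eq_div]
        refine mul_le_mul_of_nonneg_left ?_ hk₁.le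
        rw [div_le_iff₀' hpos]
        exact dotProduct_mulVec_le_lambdaMax (hpd φ).isHermitian e
    choose γ h1 h2 using h
    exact ⟨γ, h1, h2⟩
  obtain ⟨δ, hδ, hδle⟩ := exists_pos_forall_le (ι := Q × Q)
    (f := fun q => γ q.1 - m q.1 q.2 / τ q.1 q.2) fun q =>
      sub_pos.2 ((div_lt_iff₀ (hτ_pos _ _)).2 (hγτ _ _))
  have hγδ : ∀ φ φ', m φ φ' / τ φ φ' ≤ γ φ - δ := fun φ φ' => by linarith [hδle (φ, φ')]
  obtain ⟨a, ha, hale⟩ : ∃ a, 0 < a ∧ ∀ φ, ∀ e : (G φ).Edge → ℝ,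
      a * (e ⬝ᵥ e) ≤ e ⬝ᵥ P φ *ᵥ e := by
    have h : ∀ φ, ∃ a, 0 < a ∧ ∀ e : (G φ).Edge → ℝ, a * (e ⬝ᵥ e) ≤ e ⬝ᵥ P φ *ᵥ e := by
      intro φ
      rcases isEmpty_or_nonempty (G φ).Edge with h | h
      · exact ⟨1, one_pos, fun e => by simp [dotProduct]⟩
      · exact ⟨_, (hpd φ).lambdaMin_pos, lambdaMin_le_dotProduct_mulVec (hpd φ).isHermitian⟩
    choose f hf hfe using h
    obtain ⟨a, ha, hle⟩ := exists_pos_forall_le hf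
    exact ⟨a, ha, fun φ e => (mul_le_mul_of_nonneg_right (hle φ)
      (by rw [← euclNorm_sq]; positivity)).trans (hfe φ e)⟩
  set b : ℝ := ∑ φ, lambdaMax (P φ) with hb_def
  have hb : ∀ φ, lambdaMax (P φ) ≤ b := fun φ =>
    Finset.single_le_sum (fun φ _ => hmax φ) (Finset.mem_univ φ)
  have hb0 : 0 ≤ b := Finset.sum_nonneg fun φ _ => hmax φ
  set c : ℝ := 2 * b * Φbar ^ 2 with hc_def
  have hc : 0 ≤ c := by positivity
  set K : ℝ := ∑ q : Q × Q, m q.1 q.2 * (1 + Nhat q.1 q.2) with hK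
  set M : ℝ := ∑ q : Q × Q, m q.1 q.2 with hM
  -- `b + 1` instead of `b` keeps `A` positive even when `b = 0`, as strict monotonicity of `β` in
  -- the initial error demands.
  set A : ℝ := (b + 1) * Real.exp K / a with hA_def
  have hA : 0 < A := by positivity
  set B : ℝ := Real.exp (K + M) * (2 * c) / a with hB_def
  have hB : 0 ≤ B := by positivity
  -- The Lyapunov bound is quadratic in the error, so taking the root halves the rate `δ`.
  refine ⟨fun r t => Real.sqrt A * r * Real.exp (-(δ / 2 * t)), Real.sqrt B,
    isClassKL_mul_exp (Real.sqrt_pos.2 hA) (half_pos hδ), Real.sqrt_nonneg B, ?_⟩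
  rintro S ⟨-, hS⟩ x Φ hx hΦ l t ht
  set e : ∀ l : ℕ, ℝ → (G (S.mode l)).Edge → ℝ := fun l t =>
    (G (S.mode l)).syncError (vr _) (vl _) (x l t) with he_def
  have hbound := hS.lyapunov_le hNhat hτ_pos hm hδ.le hγδ
    (V := fun l t => e l t ⬝ᵥ P (S.mode l) *ᵥ e l t) (c := 2 * c) (by positivity)
    ((hpd _).posSemidef.dotProduct_mulVec_nonneg _)
    (fun l t ht => (hP (S.mode l)).le_exp_mul (hv _) (hγ _) (S.convex_closedPhase l) (hx.flow l)
      ⟨ht.1, le_rfl, fun h => (S.time_lt l h).le⟩ ht ht.2.1)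
    (fun l hl => by
      have h1 := dotProduct_mulVec_jump_le (hpd (S.mode (l + 1))) (hpd (S.mode l)) (hΞ _ _)
        (e l (S.time (l + 1))) (Φ (l + 1))
      have h2 : 2 * lambdaMax (P (S.mode (l + 1))) * (Φ (l + 1) ⬝ᵥ Φ (l + 1)) ≤ c := by
        rw [← euclNorm_sq, hc_def]
        have := hΦ l hl
        have := euclNorm_nonneg (Φ (l + 1))
        have := hb (S.mode (l + 1))
        gcongr
      rw [hexp_m]
      simp only [he_def, hx.jump l hl]
      exact (h1.trans (add_le_add_right h2 _)).trans (mul_add_le_max_mul_max (hμ _ _) hc))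
    ht
  have h0 : e 0 (S.time 0) ⬝ᵥ P (S.mode 0) *ᵥ e 0 (S.time 0) ≤
      (b + 1) * euclNorm (e 0 (S.time 0)) ^ 2 := by
    refine (dotProduct_mulVec_le_lambdaMax (hpd _).isHermitian _).trans ?_
    rw [euclNorm_sq]
    exact mul_le_mul_of_nonneg_right (by linarith [hb (S.mode 0)])
      (by rw [← euclNorm_sq]; positivity)
  refine le_sqrt_mul_add_sqrt hA.le hB (euclNorm_nonneg _) ?_
  rw [euclNorm_sq]
  have h1 := (hale _ (e l t)).trans (hbound.trans
    (add_le_add_left (mul_le_mul_of_nonneg_left h0 (Real.exp_pos _).le) _))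
  rw [← le_div_iff₀' ha] at h1
  refine h1.trans_eq ?_
  have h2 : Real.exp (K - δ * (t - S.time 0)) =
      Real.exp K * Real.exp (-(δ / 2 * (t - S.time 0) + δ / 2 * (t - S.time 0))) := by
    rw [← Real.exp_add]; congr 1; ring
  rw [h2, hA_def, hB_def]
  ring

end
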